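/- Let $\mathcal C=\mathbb Q[\hbar]$, and let $\mathfrak H=\mathcal C\langle x,y,\rho\rangle$ be the non-commutative polynomial algebra over $\mathcal C$ freely generated by $x,y,\rho$. Put $\xi=y-\rho$ and $z_k=x^{k-1}y$ for $k\ge 1$. Let $A=\{\xi\}\cup\{z_k\}_{k\ge1}$, let $\mathfrak H^1\subset\mathfrak H$ be the subalgebra generated by $A$ (it is freely generated by $A$), and let $$\widehat{\mathfrak H}^0=\mathcal C+\xi\,\mathfrak H^1+\sum_{k\ge2}z_k\,\mathfrak H^1 .$$ The integral shuffle product $ш$ is the $\mathcal C$-bilinear product on $\mathfrak H$ determined by $1\,ш\,w=w\,ш\,1=w$ and $$uw\,ш\,vw'=u(w\,ш\,vw')+v(uw\,ш\,w')+\alpha(u,v)(w\,ш\,w')\qquad(u,v\in\{x,y,\rho\},\ w,w'\in\mathfrak H),$$ where $\alpha(x,x)=\hbar x$, $\alpha(x,y)=\alpha(y,x)=0$, $\alpha(y,y)=-y\rho$, and $\alpha(u,\rho)=\alpha(\rho,u)=-u\rho$ for $u\in\{x,y,\rho\}$. Fix a complex number $q$ with $0<|q|<1$, write $[n]=(1-q^n)/(1-q)$,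 and regard $\mathbb C$ as a $\mathcal C$-module on which $\hbar$ acts as multiplication by $1-q$. For $n\ge1$ put $I_\xi(n)=q^n/[n]$ and $I_{z_k}(n)=q^{(k-1)n}/[n]^k$. Let $Z_q:\widehat{\mathfrak H}^0\to\mathbb C$ be the $\mathcal C$-linear map with $Z_q(1)=1$ and $$Z_q(u_1\cdots u_r)=\sum_{n_1>\cdots>n_r>0}\ \prod_{i=1}^r I_{u_i}(n_i)$$ for $r\ge1$, $u_1,\dots,u_r\in A$ with $u_1\ne z_1$. **Theorem.** The series that define $Z_q$ converge absolutely. Moreover, for all $w,w'\in\widehat{\mathfrak H}^0$, the product $w\,ш\,w'$ lies in $\widehat{\mathfrak H}^0$ and $$Z_q(w\,ш\,w')=Z_q(w)\,Z_q(w').$$ -/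

import Mathlib

namespace QShuffle

/-- The coefficient ring `ℚ[ħ]`. -/
abbrev Coef : Type := Polynomial ℚ

/-- The formal variable `ħ`. -/
noncomputable def hbar : Coef := Polynomial.X

/-- The three letters `x`, `y`, `ρ`. -/
inductive Letter : Type
  | x
  | y
  | rho

/-- The non-commutative polynomial algebra over `ℚ[ħ]` freely generated by `x`, `y`, `ρ`. -/
abbrev H : Type := FreeAlgebra Coef Letter

/-- A letter as an element of the algebra. -/
noncomputable def gen (u : Letter) : H := FreeAlgebra.ι Coef u

/-- `ξ = y - ρ`. -/
noncomputable def xi : H := gen Letter.y - gen Letter.rho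

/-- `z_k = x ^ (k - 1) y` for `k ≥ 1`. -/
noncomputable def z (k : ℕ+) : H := gen Letter.x ^ ((k : ℕ) - 1) * gen Letter.y

/-- Names for the elements `ξ` and `z_k` (`k ≥ 1`) of the alphabet `A`. -/
inductive Alph : Type
  | xi
  | z (k : ℕ+)

/-- The element of the algebra that a name in the alphabet `A` stands for. -/
noncomputable def Alph.toH : Alph → H
  | Alph.xi => QShuffle.xi
  | Alph.z k => QShuffle.z k

/-- The subalgebra generated by `A = {ξ} ∪ {z_k}`. -/
noncomputable def H1 : Subalgebra Coef H := Algebra.adjoin Coef (Set.range Alph.toH)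

/-- The submodule `ℚ[ħ] + ξ H¹ + ∑_{k ≥ 2} z_k H¹`. -/
noncomputable def H0hat : Submodule Coef H :=
  Submodule.span Coef {(1 : H)} ⊔ H1.toSubmodule.map (LinearMap.mulLeft Coef xi) ⊔
    ⨆ (k : ℕ+) (_ : 2 ≤ k), H1.toSubmodule.map (LinearMap.mulLeft Coef (z k))

/-! The integral shuffle product. -/

/-- The product of letters `α(u, v)`. -/
noncomputable def alpha : Letter → Letter → H
  | Letter.x, Letter.x => hbar • gen Letter.x
  | Letter.x, Letter.y => 0
  | Letter.y, Letter.x => 0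
  | Letter.y, Letter.y => -(gen Letter.y * gen Letter.rho)
  | u, Letter.rho => -(gen u * gen Letter.rho)
  | Letter.rho, u => -(gen u * gen Letter.rho)

/-- The integral shuffle product of two words in the letters `x`, `y`, `ρ`. -/
noncomputable def shWord : List Letter → List Letter → H
  | [], w => (w.map gen).prod
  | w, [] => (w.map gen).prod
  | u :: w, v :: w' =>
      gen u * shWord w (v :: w') + gen v * shWord (u :: w) w' + alpha u v * shWord w w'
  termination_by w w' => w.length + w'.length

/-- The integral shuffle product: the `ℚ[ħ]`-bilinear extension of `shWord`. -/
noncomputable def sh : H →ₗ[Coef] H →ₗ[Coef] H :=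
  (FreeAlgebra.basisFreeMonoid Coef Letter).constr Coef fun w =>
    (FreeAlgebra.basisFreeMonoid Coef Letter).constr Coef fun w' => shWord w.toList w'.toList

/-! `H1` is freely generated by the alphabet `A`. -/

/-- The algebra map from the free algebra on `A` that evaluates names. -/
noncomputable def evalA : FreeAlgebra Coef Alph →ₐ[Coef] H := FreeAlgebra.lift Coef Alph.toH

/-- The image of a word in `A` under the linear map which sends `z_k w` to `z_{k+1} w`
and all other words to `0`. -/
noncomputable def shiftWord : List Alph → FreeAlgebra Coef Alph
  | Alph.z k :: w => ((Alph.z (k + 1) :: w).map (FreeAlgebra.ι Coef)).prod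
  | _ => 0

/-- The linear extension of `shiftWord`. -/
noncomputable def shift : FreeAlgebra Coef Alph →ₗ[Coef] FreeAlgebra Coef Alph :=
  (FreeAlgebra.basisFreeMonoid Coef Alph).constr Coef fun w => shiftWord w.toList

theorem basisFreeMonoid_apply {X : Type} (w : FreeMonoid X) :
    FreeAlgebra.basisFreeMonoid Coef X w = (w.toList.map (FreeAlgebra.ι Coef)).prod := by
  simp [FreeAlgebra.basisFreeMonoid, FreeAlgebra.equivMonoidAlgebraFreeMonoid,
    FreeMonoid.lift_apply]

theorem shift_comp_mulLeft (k : ℕ+) :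
    shift * LinearMap.mulLeft Coef (FreeAlgebra.ι Coef (Alph.z k)) =
      LinearMap.mulLeft Coef (FreeAlgebra.ι Coef (Alph.z (k + 1))) := by
  refine (FreeAlgebra.basisFreeMonoid Coef Alph).ext fun w => ?_
  have h : FreeAlgebra.ι Coef (Alph.z k) * FreeAlgebra.basisFreeMonoid Coef Alph w =
      FreeAlgebra.basisFreeMonoid Coef Alph (FreeMonoid.of (Alph.z k) * w) := by
    simp [basisFreeMonoid_apply]
  rw [Module.End.mul_apply, LinearMap.mulLeft_apply, LinearMap.mulLeft_apply, h, shift,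
    Module.Basis.constr_basis]
  simp [shiftWord, basisFreeMonoid_apply]

/-- The action of `x`, `y`, `ρ` on the free algebra on `A` through which words are decoded. -/
noncomputable def decode : H →ₐ[Coef] Module.End Coef (FreeAlgebra Coef Alph) :=
  FreeAlgebra.lift Coef fun
    | Letter.x => shift
    | Letter.y => LinearMap.mulLeft Coef (FreeAlgebra.ι Coef (Alph.z 1))
    | Letter.rho =>
        LinearMap.mulLeft Coef (FreeAlgebra.ι Coef (Alph.z 1) - FreeAlgebra.ι Coef Alph.xi)

theorem decode_z (k : ℕ+) :
    decode (z k) = LinearMap.mulLeft Coef (FreeAlgebra.ι Coef (Alph.z k)) := by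
  induction k using PNat.recOn with
  | one => simp [z, gen, decode]
  | succ k ih =>
    have hz : z (k + 1) = gen Letter.x * z k := by
      have : ((k + 1 : ℕ+) : ℕ) - 1 = ((k : ℕ) - 1) + 1 := by
        have := k.pos
        simp only [PNat.add_coe, PNat.one_coe]
        omega
      rw [z, z, this, pow_succ', mul_assoc]
    rw [hz, map_mul, ih, ← shift_comp_mulLeft]
    simp [gen, decode]

theorem decode_comp_evalA : decode.comp evalA = Algebra.lmul Coef (FreeAlgebra Coef Alph) := by
  refine FreeAlgebra.hom_ext (funext fun a => ?_)
  cases a with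
  | xi =>
    refine LinearMap.ext fun w => ?_
    simp [evalA, Alph.toH, xi, gen, decode, sub_mul]
  | z k =>
    refine LinearMap.ext fun w => ?_
    simp [evalA, Alph.toH, decode_z]

theorem evalA_injective : Function.Injective evalA := by
  intro a b hab
  have h : ∀ c, decode (evalA c) 1 = c := fun c => by
    have := DFunLike.congr_fun (DFunLike.congr_fun decode_comp_evalA c) 1
    simpa using this
  rw [← h a, ← h b, hab]

theorem range_evalA : evalA.range = H1 :=
  (Algebra.adjoin_range_eq_range_freeAlgebra_lift _ _ Alph.toH).symm

/-- `H1` is the free algebra on `A`. -/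
noncomputable def freeEquivH1 : FreeAlgebra Coef Alph ≃ₐ[Coef] H1 :=
  (AlgEquiv.ofInjective evalA evalA_injective).trans (Subalgebra.equivOfEq _ _ range_evalA)

theorem toH_mem_H1 (a : Alph) : a.toH ∈ H1 := Algebra.subset_adjoin ⟨a, rfl⟩

theorem H0hat_le_H1 : H0hat ≤ H1.toSubmodule := by
  refine sup_le (sup_le ?_ ?_) (iSup₂_le fun k _ => ?_)
  · rw [Submodule.span_le, Set.singleton_subset_iff]
    exact H1.one_mem
  · rintro _ ⟨w, hw, rfl⟩
    exact H1.mul_mem (toH_mem_H1 Alph.xi) hw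
  · rintro _ ⟨w, hw, rfl⟩
    exact H1.mul_mem (toH_mem_H1 (Alph.z k)) hw

/-! The evaluation `Z_q`. -/

/-- The ring map `ℚ[ħ] → ℂ`, `ħ ↦ 1 - q`, which makes `ℂ` a `ℚ[ħ]`-module. -/
noncomputable def coefEval (q : ℂ) : Coef →+* ℂ := (Polynomial.aeval (1 - q)).toRingHom

/-- The `q`-integer `[n] = (1 - q ^ n) / (1 - q)`. -/
noncomputable def qInt (q : ℂ) (n : ℕ) : ℂ := (1 - q ^ n) / (1 - q)

/-- `I_ξ(n) = q ^ n / [n]` and `I_{z_k}(n) = q ^ ((k - 1) n) / [n] ^ k`. -/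
noncomputable def I (q : ℂ) : Alph → ℕ → ℂ
  | Alph.xi, n => q ^ n / qInt q n
  | Alph.z k, n => q ^ (((k : ℕ) - 1) * n) / qInt q n ^ (k : ℕ)

/-- The tuples `n_1 > ⋯ > n_r > 0`. -/
abbrev DecTuple (r : ℕ) : Type := {n : Fin r → ℕ // StrictAnti n ∧ ∀ i, 0 < n i}

/-- The summand of the series attached to the word `u_1 ⋯ u_r` in `A`. -/
noncomputable def term (q : ℂ) (l : List Alph) (n : DecTuple l.length) : ℂ :=
  ∏ i : Fin l.length, I q (l.get i) (n.1 i)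

/-- The series `∑_{n_1 > ⋯ > n_r > 0} ∏ I_{u_i}(n_i)` attached to the word `u_1 ⋯ u_r` in `A`;
its value at the empty word is `1`. -/
noncomputable def wordSeries (q : ℂ) (l : List Alph) : ℂ := ∑' n : DecTuple l.length, term q l n

/-- The map `∑ c_w w ↦ ∑ c_w(1 - q) wordSeries w` on the free algebra on `A`. It has no meaning
on words that start with `z_1`, where the series may diverge. -/
noncomputable def freeZ (q : ℂ) : FreeAlgebra Coef Alph →ₛₗ[coefEval q] ℂ where
  toFun f := ((FreeAlgebra.basisFreeMonoid Coef Alph).repr f).sum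
    fun w c => coefEval q c * wordSeries q w.toList
  map_add' f g := by
    rw [map_add]
    exact Finsupp.sum_add_index' (by simp) (by simp [add_mul])
  map_smul' c f := by
    rw [map_smul, Finsupp.sum_smul_index (by simp), smul_eq_mul, Finsupp.mul_sum]
    simp [mul_assoc]

/-- The map `Z_q` on `H0hat`. It is `ℚ[ħ]`-linear, where `ħ` acts on `ℂ` as `1 - q`, and its value
at a word `u_1 ⋯ u_r` in `A` which lies in `H0hat` is `∑_{n_1 > ⋯ > n_r > 0} ∏ I_{u_i}(n_i)`. -/
noncomputable def Z (q : ℂ) : H0hat →ₛₗ[coefEval q] ℂ :=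
  (freeZ q).comp ((freeEquivH1.symm.toLinearMap).comp (Submodule.inclusion H0hat_le_H1))

end QShuffle

/-!
Words in `x`, `y`, `ρ` are read as iterated Jackson integrals. Let `σ` be the substitution
`t ↦ q t` on `ℂ⟦t⟧` and `h = (1 - q) t / (1 - t)`. On series without constant term `1 - σ` is
invertible, and since `σ` is a ring homomorphism its inverse `D` satisfies the Rota–Baxter identity
`D f * D g = D (f * D g + D f * g - f * g)` (`qInv_mul_qInv`). Let `x`, `y`, `ρ` act by
`f ↦ D ((1 - q) σ f)`, `f ↦ D (h f)` and `f ↦ h f`. Then the product of two series `u f`, `v g`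
obeys exactly the recursion that defines the shuffle product, with `α(u, v)` as the correction
term. Hence the semilinear map `toPS`, which sends a word to the series obtained by applying its
letters to `1`, turns the shuffle product on `H1` into the product of series (`toPS_sh`). The
formulas that involve `x` require the series that `x` acts on to have no constant term; this
holds for the words in which every `x` is followed by `x` or `y`, and these span `H1`.

The letters `ξ` and `z_k` act on coefficients by
`f_n ↦ I_u(n) ∑_{m < n} f_m` (`coeff_toPS_toH_mul`). So the coefficient of `t ^ n` in the series of
a word in `A` is the part of the multiple sum with `n_1 = n`. The weights are bounded, and decay
geometrically for `u ≠ z_1`, so these coefficients are absolutely summable on `H0hat` with sum `Z`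
(`summable_and_hasSum_Z`). Multiplicativity of `Z` is the Cauchy product of absolutely
convergent series.

That `H0hat` is stable (`sh_mem_H0hat`) is algebra. The letter `ρ` passes through the shuffle
product (`sh_rho_mul_left`, `sh_rho_mul_right`), so an induction on words shows that `H1` and
`∑_{k ≥ 1} z_k H1` are stable; then `H0hat = ℚ[ħ] + ξ H1 + x ∑_{k ≥ 1} z_k H1` reduces the claim to
the products of elements `ξ a` and `x b`.
-/

namespace QShuffle

/-! ### The shuffle product on the algebra -/

/-- The element of the algebra given by a word in the letters. -/
noncomputable def word (w : List Letter) : H := (w.map gen).prod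

@[simp] theorem word_nil : word [] = 1 := rfl

@[simp] theorem word_cons (u : Letter) (w : List Letter) : word (u :: w) = gen u * word w := rfl

theorem basis_ofList (w : List Letter) :
    FreeAlgebra.basisFreeMonoid Coef Letter (FreeMonoid.ofList w) = word w :=
  basisFreeMonoid_apply _

theorem span_range_word : Submodule.span Coef (Set.range word) = ⊤ := by
  rw [← (FreeAlgebra.basisFreeMonoid Coef Letter).span_eq]
  congr 1
  exact Set.Subset.antisymm (by rintro _ ⟨w, rfl⟩; exact ⟨FreeMonoid.ofList w, basis_ofList w⟩)
    (by rintro _ ⟨w, rfl⟩; exact ⟨w.toList, (basis_ofList w.toList).symm⟩)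

@[elab_as_elim]
theorem word_induction {p : H → Prop} (a : H) (hw : ∀ w, p (word w))
    (hadd : ∀ a b, p a → p b → p (a + b)) (hsmul : ∀ (c : Coef) a, p a → p (c • a)) : p a := by
  have ha : a ∈ Submodule.span Coef (Set.range word) := span_range_word ▸ Submodule.mem_top
  induction ha using Submodule.span_induction with
  | mem _ h => obtain ⟨w, rfl⟩ := h; exact hw w
  | zero => simpa using hsmul 0 _ (hw [])
  | add a b _ _ ha hb => exact hadd a b ha hb
  | smul c a _ ha => exact hsmul c a ha

theorem sh_word (w w' : List Letter) : sh (word w) (word w') = shWord w w' := by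
  rw [← basis_ofList, ← basis_ofList, sh, Module.Basis.constr_basis, Module.Basis.constr_basis]
  rfl

@[simp] theorem sh_one_left (b : H) : sh 1 b = b := by
  induction b using word_induction with
  | hw w => rw [← word_nil, sh_word, shWord]; rfl
  | hadd a b ha hb => rw [map_add, ha, hb]
  | hsmul c a ha => rw [map_smul, ha]

@[simp] theorem sh_one_right (a : H) : sh a 1 = a := by
  induction a using word_induction with
  | hw w => rw [← word_nil, sh_word]; cases w <;> simp [shWord, word]
  | hadd a b ha hb => rw [map_add, LinearMap.add_apply, ha, hb]
  | hsmul c a ha => rw [map_smul, LinearMap.smul_apply, ha]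

theorem sh_gen_mul_gen_mul (u v : Letter) (a b : H) :
    sh (gen u * a) (gen v * b) =
      gen u * sh a (gen v * b) + gen v * sh (gen u * a) b + alpha u v * sh a b := by
  induction a using word_induction with
  | hw w =>
    induction b using word_induction with
    | hw w' => simp only [← word_cons, sh_word]; rw [shWord]
    | hadd a b ha hb => simp only [mul_add, map_add, ha, hb]; abel
    | hsmul c a ha => simp only [mul_smul_comm, map_smul, ha, smul_add]
  | hadd a b ha hb => simp only [mul_add, map_add, LinearMap.add_apply, ha, hb]; abel
  | hsmul c a ha => simp only [mul_smul_comm, map_smul, LinearMap.smul_apply, ha, smul_add]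

theorem alpha_rho_right_mul (u : Letter) (a : H) :
    alpha u .rho * a = -(gen u * (gen .rho * a)) := by
  have h : alpha u .rho = -(gen u * gen .rho) := by cases u <;> rfl
  -- The arguments are explicit because `-` and `*` on `H` come from instances that `rw` does not
  -- unify.
  rw [h, neg_mul (gen u * gen .rho) a, mul_assoc]

theorem alpha_rho_left_mul (u : Letter) (a : H) :
    alpha .rho u * a = -(gen u * (gen .rho * a)) := by
  have h : alpha .rho u = -(gen u * gen .rho) := by cases u <;> rfl
  rw [h, neg_mul (gen u * gen .rho) a, mul_assoc]

theorem alpha_y_y_mul (a : H) : alpha .y .y * a = -(gen .y * (gen .rho * a)) := by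
  rw [alpha, neg_mul (gen .y * gen .rho) a, mul_assoc]

/-- The letter `ρ` acts as a scalar of the shuffle product: the correction term `α(u, ρ) = -uρ`
cancels the term in which `ρ` does not come first. -/
theorem sh_rho_mul_right (a b : H) : sh a (gen .rho * b) = gen .rho * sh a b := by
  induction a using word_induction with
  | hw w =>
    induction w with
    | nil => simp
    | cons u w ih => rw [word_cons, sh_gen_mul_gen_mul, ih, alpha_rho_right_mul]; abel
  | hadd a b ha hb => simp only [map_add, LinearMap.add_apply, ha, hb, mul_add]
  | hsmul c a ha => simp only [map_smul, LinearMap.smul_apply, ha, mul_smul_comm]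

theorem sh_rho_mul_left (a b : H) : sh (gen .rho * a) b = gen .rho * sh a b := by
  induction b using word_induction with
  | hw w =>
    induction w with
    | nil => simp
    | cons u w ih => rw [word_cons, sh_gen_mul_gen_mul, ih, alpha_rho_left_mul]; abel
  | hadd a b ha hb => simp only [map_add, ha, hb, mul_add]
  | hsmul c a ha => simp only [map_smul, ha, mul_smul_comm]

theorem sh_x_mul_x_mul (a b : H) : sh (gen .x * a) (gen .x * b) =
    gen .x * (sh a (gen .x * b) + sh (gen .x * a) b + hbar • sh a b) := by
  rw [sh_gen_mul_gen_mul, alpha]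
  simp only [mul_add, smul_mul_assoc, mul_smul_comm]

theorem sh_x_mul_y_mul (a b : H) : sh (gen .x * a) (gen .y * b) =
    gen .x * sh a (gen .y * b) + gen .y * sh (gen .x * a) b := by
  rw [sh_gen_mul_gen_mul, alpha, zero_mul, add_zero]

theorem sh_y_mul_x_mul (a b : H) : sh (gen .y * a) (gen .x * b) =
    gen .y * sh a (gen .x * b) + gen .x * sh (gen .y * a) b := by
  rw [sh_gen_mul_gen_mul, alpha, zero_mul, add_zero]

theorem sh_y_mul_y_mul (a b : H) : sh (gen .y * a) (gen .y * b) =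
    gen .y * (sh a (gen .y * b) + sh (gen .y * a) b - gen .rho * sh a b) := by
  rw [sh_gen_mul_gen_mul, alpha_y_y_mul, mul_sub, mul_add]
  abel

theorem sh_xi_mul_xi_mul (a b : H) : sh (xi * a) (xi * b) =
    xi * (sh a (gen .y * b) + sh (gen .y * a) b - gen .rho * sh a b) := by
  simp only [xi, sub_mul, map_sub, LinearMap.sub_apply, sh_rho_mul_left, sh_rho_mul_right,
    sh_y_mul_y_mul, sub_mul, mul_sub, mul_add]
  abel

theorem sh_xi_mul_x_mul (a b : H) : sh (xi * a) (gen .x * b) =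
    gen .x * sh (gen .y * a) b + xi * sh a (gen .x * b) := by
  simp only [xi, sub_mul, map_sub, LinearMap.sub_apply, sh_rho_mul_left, sh_y_mul_x_mul]
  abel

theorem sh_x_mul_xi_mul (a b : H) : sh (gen .x * a) (xi * b) =
    gen .x * sh a (gen .y * b) + xi * sh (gen .x * a) b := by
  simp only [xi, sub_mul, map_sub, sh_rho_mul_right, sh_x_mul_y_mul]
  abel

/-! ### Stability of the submodules under the shuffle product -/

/-- The submodule `∑_{k ≥ 1} z_k H¹`. -/
noncomputable def H1z : Submodule Coef H :=
  ⨆ k : ℕ+, H1.toSubmodule.map (LinearMap.mulLeft Coef (z k))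

theorem gen_x_mul_z (k : ℕ+) : gen .x * z k = z (k + 1) := by
  have : ((k + 1 : ℕ+) : ℕ) - 1 = ((k : ℕ) - 1) + 1 := by
    have := k.pos
    simp only [PNat.add_coe, PNat.one_coe]
    omega
  rw [z, z, this, pow_succ', mul_assoc]

theorem z_one : z 1 = gen .y := by simp [z]

theorem z_mul_mem_H1z (k : ℕ+) {a : H} (ha : a ∈ H1) : z k * a ∈ H1z :=
  Submodule.mem_iSup_of_mem k ⟨a, ha, rfl⟩

theorem y_mul_mem_H1z {a : H} (ha : a ∈ H1) : gen .y * a ∈ H1z :=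
  z_one ▸ z_mul_mem_H1z 1 ha

theorem H1z_le_H1 : H1z ≤ H1.toSubmodule := by
  refine iSup_le fun k => ?_
  rintro _ ⟨w, hw, rfl⟩
  exact H1.mul_mem (toH_mem_H1 (.z k)) hw

theorem x_mul_mem_H1z {a : H} (ha : a ∈ H1z) : gen .x * a ∈ H1z := by
  suffices h : H1z ≤ H1z.comap (LinearMap.mulLeft Coef (gen .x)) from h ha
  refine iSup_le fun k => ?_
  rintro _ ⟨w, hw, rfl⟩
  change gen .x * (z k * w) ∈ H1z
  rw [← mul_assoc, gen_x_mul_z]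
  exact z_mul_mem_H1z _ hw

theorem rho_mul_mem_H1 {a : H} (ha : a ∈ H1) : gen .rho * a ∈ H1 := by
  have h : gen .rho = Alph.toH (.z 1) - Alph.toH .xi := by simp [Alph.toH, z_one, xi]
  rw [h]
  exact H1.mul_mem (H1.sub_mem (toH_mem_H1 _) (toH_mem_H1 _)) ha

/-- A nonempty word that does not start with `ρ`. -/
def StartsXY : List Letter → Prop
  | .x :: _ => True
  | .y :: _ => True
  | _ => False

/-- A word in which every `x` is followed by `x` or `y`; these words span `H1`. -/
def Good : List Letter → Prop
  | [] => True
  | .x :: w => StartsXY w ∧ Good w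
  | .y :: w => Good w
  | .rho :: w => Good w

theorem gen_mul_mem_span {u : Letter} {P Q : List Letter → Prop} (h : ∀ w, P w → Q (u :: w))
    {a : H} (ha : a ∈ Submodule.span Coef (word '' {w | P w})) :
    gen u * a ∈ Submodule.span Coef (word '' {w | Q w}) := by
  suffices hs : Submodule.span Coef (word '' {w | P w}) ≤
      (Submodule.span Coef (word '' {w | Q w})).comap (LinearMap.mulLeft Coef (gen u)) from hs ha
  rw [Submodule.span_le]
  rintro _ ⟨w, hw, rfl⟩
  exact Submodule.subset_span ⟨u :: w, h w hw, rfl⟩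

theorem z_mul_mem_span (k : ℕ+) {a : H} (ha : a ∈ Submodule.span Coef (word '' {w | Good w})) :
    z k * a ∈ Submodule.span Coef (word '' {w | StartsXY w ∧ Good w}) := by
  induction k using PNat.recOn with
  | one => rw [z_one]; exact gen_mul_mem_span (fun w hw => ⟨trivial, hw⟩) ha
  | succ k ih =>
    rw [← gen_x_mul_z, mul_assoc]
    exact gen_mul_mem_span (fun w hw => ⟨trivial, hw⟩) ih

theorem H1_le_span_good : H1.toSubmodule ≤ Submodule.span Coef (word '' {w | Good w}) := by
  intro a ha
  suffices h : ∀ b ∈ Submodule.span Coef (word '' {w | Good w}),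
      a * b ∈ Submodule.span Coef (word '' {w | Good w}) by
    simpa using h 1 (Submodule.subset_span ⟨[], trivial, rfl⟩)
  change a ∈ Algebra.adjoin Coef (Set.range Alph.toH) at ha
  induction ha using Algebra.adjoin_induction with
  | mem a h =>
    obtain ⟨a, rfl⟩ := h
    intro b hb
    cases a with
    | xi =>
      rw [Alph.toH, xi, sub_mul]
      exact Submodule.sub_mem _ (gen_mul_mem_span (fun w hw => hw) hb)
        (gen_mul_mem_span (fun w hw => hw) hb)
    | z k =>
      exact Submodule.span_mono (Set.image_mono fun w hw => hw.2) (z_mul_mem_span k hb)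
  | algebraMap r =>
    intro b hb
    rw [← Algebra.smul_def]
    exact Submodule.smul_mem _ _ hb
  | add a b _ _ ha hb =>
    intro c hc
    rw [add_mul]
    exact Submodule.add_mem _ (ha c hc) (hb c hc)
  | mul a b _ _ ha hb =>
    intro c hc
    rw [mul_assoc]
    exact ha _ (hb c hc)

theorem H1z_le_span_good :
    H1z ≤ Submodule.span Coef (word '' {w | StartsXY w ∧ Good w}) := by
  refine iSup_le fun k => ?_
  rintro _ ⟨w, hw, rfl⟩
  exact z_mul_mem_span k (H1_le_span_good hw)

theorem word_mem_of_good {w : List Letter} (hw : Good w) :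
    word w ∈ H1 ∧ (StartsXY w → word w ∈ H1z) := by
  induction w with
  | nil => exact ⟨H1.one_mem, fun h => h.elim⟩
  | cons u w ih =>
    cases u with
    | x =>
      have h := x_mul_mem_H1z ((ih hw.2).2 hw.1)
      exact ⟨H1z_le_H1 h, fun _ => h⟩
    | y =>
      have h := y_mul_mem_H1z (ih hw).1
      exact ⟨H1z_le_H1 h, fun _ => h⟩
    | rho => exact ⟨rho_mul_mem_H1 (ih hw).1, fun h => h.elim⟩

/-- The stability of `H1` and of `H1z`, proved together by induction on the total length: an
element `x a` is known to lie in `H1` only when `a` lies in `H1z`. -/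
theorem sh_word_mem_of_good {w w' : List Letter} (hw : Good w) (hw' : Good w') :
    sh (word w) (word w') ∈ H1 ∧
      (StartsXY w → StartsXY w' → sh (word w) (word w') ∈ H1z) := by
  match w, w', hw, hw' with
  | [], w', _, hw' => simpa [StartsXY] using (word_mem_of_good hw').1
  | w, [], hw, _ => simpa [StartsXY] using (word_mem_of_good hw).1
  | .rho :: w, w', hw, hw' =>
    rw [word_cons, sh_rho_mul_left]
    exact ⟨rho_mul_mem_H1 (sh_word_mem_of_good (w := w) hw hw').1, fun h => h.elim⟩
  | w, .rho :: w', hw, hw' =>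
    rw [word_cons, sh_rho_mul_right]
    exact ⟨rho_mul_mem_H1 (sh_word_mem_of_good (w' := w') hw hw').1, fun _ h => h.elim⟩
  | .x :: w, .x :: w', hw, hw' =>
    have h : sh (word (.x :: w)) (word (.x :: w')) ∈ H1z := by
      rw [word_cons, word_cons, sh_x_mul_x_mul, ← word_cons, ← word_cons]
      exact x_mul_mem_H1z (add_mem (add_mem
        ((sh_word_mem_of_good hw.2 hw').2 hw.1 trivial)
        ((sh_word_mem_of_good hw hw'.2).2 trivial hw'.1))
        (Submodule.smul_mem _ _ ((sh_word_mem_of_good hw.2 hw'.2).2 hw.1 hw'.1)))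
    exact ⟨H1z_le_H1 h, fun _ _ => h⟩
  | .x :: w, .y :: w', hw, hw' =>
    have h : sh (word (.x :: w)) (word (.y :: w')) ∈ H1z := by
      rw [word_cons, word_cons, sh_x_mul_y_mul, ← word_cons, ← word_cons]
      exact add_mem (x_mul_mem_H1z ((sh_word_mem_of_good hw.2 hw').2 hw.1 trivial))
        (y_mul_mem_H1z (sh_word_mem_of_good (w' := w') hw hw').1)
    exact ⟨H1z_le_H1 h, fun _ _ => h⟩
  | .y :: w, .x :: w', hw, hw' =>
    have h : sh (word (.y :: w)) (word (.x :: w')) ∈ H1z := by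
      rw [word_cons, word_cons, sh_y_mul_x_mul, ← word_cons, ← word_cons]
      exact add_mem (y_mul_mem_H1z (sh_word_mem_of_good (w := w) hw hw').1)
        (x_mul_mem_H1z ((sh_word_mem_of_good hw hw'.2).2 trivial hw'.1))
    exact ⟨H1z_le_H1 h, fun _ _ => h⟩
  | .y :: w, .y :: w', hw, hw' =>
    have h : sh (word (.y :: w)) (word (.y :: w')) ∈ H1z := by
      rw [word_cons, word_cons, sh_y_mul_y_mul, ← word_cons, ← word_cons]
      exact y_mul_mem_H1z (sub_mem (add_mem
        (sh_word_mem_of_good (w := w) hw hw').1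
        (sh_word_mem_of_good (w' := w') hw hw').1)
        (rho_mul_mem_H1 (sh_word_mem_of_good (w := w) (w' := w') hw hw').1))
    exact ⟨H1z_le_H1 h, fun _ _ => h⟩
  termination_by w.length + w'.length

theorem sh_mem_of_mem_span {S T : Set H} {P : Submodule Coef H} (h : ∀ a ∈ S, ∀ b ∈ T, sh a b ∈ P)
    {a b : H} (ha : a ∈ Submodule.span Coef S) (hb : b ∈ Submodule.span Coef T) : sh a b ∈ P := by
  have := Submodule.apply_mem_map₂ sh ha hb
  rw [Submodule.map₂_span_span] at this
  exact Submodule.span_le.2 (by rintro _ ⟨a, ha, b, hb, rfl⟩; exact h a ha b hb) this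

theorem sh_mem_H1 {a b : H} (ha : a ∈ H1) (hb : b ∈ H1) : sh a b ∈ H1 :=
  sh_mem_of_mem_span (P := H1.toSubmodule)
    (by rintro _ ⟨w, hw, rfl⟩ _ ⟨w', hw', rfl⟩; exact (sh_word_mem_of_good hw hw').1)
    (H1_le_span_good ha) (H1_le_span_good hb)

theorem sh_mem_H1z {a b : H} (ha : a ∈ H1z) (hb : b ∈ H1z) : sh a b ∈ H1z :=
  sh_mem_of_mem_span
    (by rintro _ ⟨w, hw, rfl⟩ _ ⟨w', hw', rfl⟩
        exact (sh_word_mem_of_good hw.2 hw'.2).2 hw.1 hw'.1)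
    (H1z_le_span_good ha) (H1z_le_span_good hb)

theorem xi_mul_mem_H0hat {a : H} (ha : a ∈ H1) : xi * a ∈ H0hat :=
  Submodule.mem_sup_left (Submodule.mem_sup_right ⟨a, ha, rfl⟩)

theorem x_mul_mem_H0hat {a : H} (ha : a ∈ H1z) : gen .x * a ∈ H0hat := by
  suffices h : H1z ≤ H0hat.comap (LinearMap.mulLeft Coef (gen .x)) from h ha
  refine iSup_le fun k => ?_
  rintro _ ⟨w, hw, rfl⟩
  change gen .x * (z k * w) ∈ H0hat
  rw [← mul_assoc, gen_x_mul_z]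
  refine Submodule.mem_sup_right (Submodule.mem_iSup_of_mem (k + 1)
    (Submodule.mem_iSup_of_mem ?_ ⟨w, hw, rfl⟩))
  rw [← PNat.coe_le_coe]
  have := k.pos
  simp only [PNat.add_coe, PNat.val_ofNat]
  omega

/-- `H0hat` is `ℚ[ħ] + ξ H¹ + x ∑_{k ≥ 1} z_k H¹`, since `z_{k+1} = x z_k`. -/
theorem exists_eq_of_mem_H0hat {a : H} (ha : a ∈ H0hat) :
    ∃ c : Coef, ∃ b ∈ H1, ∃ d ∈ H1z, a = c • 1 + xi * b + gen .x * d := by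
  obtain ⟨a', ha', e, he, rfl⟩ := Submodule.mem_sup.1 ha
  obtain ⟨c', hc', b', ⟨b, hb, rfl⟩, rfl⟩ := Submodule.mem_sup.1 ha'
  obtain ⟨c, rfl⟩ := Submodule.mem_span_singleton.1 hc'
  have : e ∈ H1z.map (LinearMap.mulLeft Coef (gen .x)) := by
    refine (iSup₂_le (fun k hk => ?_) : (_ : Submodule Coef H) ≤ _) he
    rintro _ ⟨w, hw, rfl⟩
    obtain ⟨j, rfl⟩ : ∃ j : ℕ+, k = j + 1 :=
      ⟨k - 1, by rw [add_comm]; exact (PNat.add_sub_of_lt (lt_of_lt_of_le (by decide) hk)).symm⟩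
    exact ⟨z j * w, z_mul_mem_H1z j hw, by simp [← gen_x_mul_z]⟩
  obtain ⟨d, hd, rfl⟩ := this
  exact ⟨c, b, hb, d, hd, rfl⟩

theorem sh_mem_H0hat {a a' : H} (ha : a ∈ H0hat) (ha' : a' ∈ H0hat) : sh a a' ∈ H0hat := by
  obtain ⟨c, b, hb, d, hd, h⟩ := exists_eq_of_mem_H0hat ha
  obtain ⟨c', b', hb', d', hd', h'⟩ := exists_eq_of_mem_H0hat ha'
  have hxb : sh (xi * b) (xi * b') ∈ H0hat := by
    rw [sh_xi_mul_xi_mul]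
    exact xi_mul_mem_H0hat (sub_mem
      (add_mem (sh_mem_H1 hb (H1z_le_H1 (y_mul_mem_H1z hb')))
        (sh_mem_H1 (H1z_le_H1 (y_mul_mem_H1z hb)) hb')) (rho_mul_mem_H1 (sh_mem_H1 hb hb')))
  have hxd : sh (xi * b) (gen .x * d') ∈ H0hat := by
    rw [sh_xi_mul_x_mul]
    exact add_mem (x_mul_mem_H0hat (sh_mem_H1z (y_mul_mem_H1z hb) hd'))
      (xi_mul_mem_H0hat (sh_mem_H1 hb (H1z_le_H1 (x_mul_mem_H1z hd'))))
  have hdx : sh (gen .x * d) (xi * b') ∈ H0hat := by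
    rw [sh_x_mul_xi_mul]
    exact add_mem (x_mul_mem_H0hat (sh_mem_H1z hd (y_mul_mem_H1z hb')))
      (xi_mul_mem_H0hat (sh_mem_H1 (H1z_le_H1 (x_mul_mem_H1z hd)) hb'))
  have hdd : sh (gen .x * d) (gen .x * d') ∈ H0hat := by
    rw [sh_x_mul_x_mul]
    exact x_mul_mem_H0hat (add_mem (add_mem (sh_mem_H1z hd (x_mul_mem_H1z hd'))
      (sh_mem_H1z (x_mul_mem_H1z hd) hd')) (Submodule.smul_mem _ _ (sh_mem_H1z hd hd')))
  have key : sh a a' = c • a' + c' • (xi * b + gen .x * d) +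
      (sh (xi * b) (xi * b') + sh (xi * b) (gen .x * d') +
        (sh (gen .x * d) (xi * b') + sh (gen .x * d) (gen .x * d'))) := by
    rw [h, h']
    simp only [map_add, map_smul, LinearMap.add_apply, LinearMap.smul_apply, sh_one_left,
      sh_one_right, smul_add]
    rw [smul_comm c' c]
    abel
  rw [key]
  exact add_mem (add_mem (Submodule.smul_mem _ _ ha') (Submodule.smul_mem _ _
    (add_mem (xi_mul_mem_H0hat hb) (x_mul_mem_H0hat hd)))) (add_mem (add_mem hxb hxd)
    (add_mem hdx hdd))

/-! ### Letters as operators on power series -/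

/-- The operator `t ^ n ↦ t ^ n / (1 - q ^ n)` on power series. On series without constant term
it is inverse to `1 - σ`, where `σ` is the substitution `t ↦ q t`; the constant term is sent
to `0`. -/
noncomputable def qInv (q : ℂ) : PowerSeries ℂ →ₗ[ℂ] PowerSeries ℂ where
  toFun f := PowerSeries.mk fun n => (1 - q ^ n)⁻¹ * PowerSeries.coeff n f
  map_add' f g := by ext n; simp [mul_add]
  map_smul' c f := by ext n; simp [mul_left_comm]

theorem coeff_qInv (q : ℂ) (f : PowerSeries ℂ) (n : ℕ) :
    PowerSeries.coeff n (qInv q f) = (1 - q ^ n)⁻¹ * PowerSeries.coeff n f :=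
  PowerSeries.coeff_mk n fun n => (1 - q ^ n)⁻¹ * PowerSeries.coeff n f

@[simp] theorem constantCoeff_qInv (q : ℂ) (f : PowerSeries ℂ) :
    PowerSeries.constantCoeff (qInv q f) = 0 := by
  rw [← PowerSeries.coeff_zero_eq_constantCoeff_apply, coeff_qInv]
  simp

theorem one_sub_pow_ne_zero {q : ℂ} (hq : ‖q‖ < 1) {n : ℕ} (hn : n ≠ 0) : 1 - q ^ n ≠ 0 := by
  intro h
  have h1 : ‖q‖ ^ n = 1 := by rw [← norm_pow, ← sub_eq_zero.1 h, norm_one]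
  exact (pow_lt_one₀ (norm_nonneg q) hq hn).ne h1

theorem eq_qInv {q : ℂ} (hq : ‖q‖ < 1) {f g : PowerSeries ℂ}
    (h0 : PowerSeries.constantCoeff f = 0) (h : f - PowerSeries.rescale q f = g) :
    f = qInv q g := by
  ext n
  rw [coeff_qInv, ← h, map_sub, PowerSeries.coeff_rescale]
  rcases eq_or_ne n 0 with rfl | hn
  · simpa using h0
  · field_simp [one_sub_pow_ne_zero hq hn]

theorem qInv_sub_rescale {q : ℂ} (hq : ‖q‖ < 1) {f : PowerSeries ℂ}
    (h0 : PowerSeries.constantCoeff f = 0) :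
    PowerSeries.rescale q (qInv q f) = qInv q f - f := by
  ext n
  rw [map_sub, PowerSeries.coeff_rescale, coeff_qInv]
  rcases eq_or_ne n 0 with rfl | hn
  · simpa using h0
  · field_simp [one_sub_pow_ne_zero hq hn]
    ring

/-- The Rota–Baxter identity for `(1 - σ)⁻¹`; it holds because `σ` is multiplicative. -/
theorem qInv_mul_qInv {q : ℂ} (hq : ‖q‖ < 1) {f g : PowerSeries ℂ}
    (hf : PowerSeries.constantCoeff f = 0) (hg : PowerSeries.constantCoeff g = 0) :
    qInv q f * qInv q g = qInv q (f * qInv q g + qInv q f * g - f * g) := by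
  refine eq_qInv hq (by simp) ?_
  rw [map_mul, qInv_sub_rescale hq hf, qInv_sub_rescale hq hg]
  ring

/-- The series `(1 - q) t / (1 - t)`. -/
noncomputable def geomSeries (q : ℂ) : PowerSeries ℂ :=
  PowerSeries.C (1 - q) * (PowerSeries.X * PowerSeries.mk 1)

@[simp] theorem constantCoeff_geomSeries (q : ℂ) :
    PowerSeries.constantCoeff (geomSeries q) = 0 := by
  simp [geomSeries]

theorem coeff_geomSeries_mul (q : ℂ) (f : PowerSeries ℂ) (n : ℕ) :
    PowerSeries.coeff n (geomSeries q * f) =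
      (1 - q) * ∑ m ∈ Finset.range n, PowerSeries.coeff m f := by
  rw [geomSeries, mul_assoc, PowerSeries.coeff_C_mul, mul_assoc]
  cases n with
  | zero => simp
  | succ n =>
    rw [PowerSeries.coeff_succ_X_mul, mul_comm (PowerSeries.mk 1), PowerSeries.coeff_mul,
      Finset.Nat.sum_antidiagonal_eq_sum_range_succ_mk]
    simp

@[simp] theorem constantCoeff_rescale (q : ℂ) (f : PowerSeries ℂ) :
    PowerSeries.constantCoeff (PowerSeries.rescale q f) = PowerSeries.constantCoeff f := by
  rw [← PowerSeries.coeff_zero_eq_constantCoeff_apply, PowerSeries.coeff_rescale]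
  simp

theorem rescale_C (q c : ℂ) :
    PowerSeries.rescale q (PowerSeries.C c) = PowerSeries.C c := by
  ext n
  rcases eq_or_ne n 0 with rfl | hn <;> simp [PowerSeries.coeff_rescale, PowerSeries.coeff_C, *]

theorem rescale_smul (q c : ℂ) (f : PowerSeries ℂ) :
    PowerSeries.rescale q (c • f) = c • PowerSeries.rescale q f := by
  rw [PowerSeries.smul_eq_C_mul, map_mul, rescale_C, PowerSeries.smul_eq_C_mul]

/-- The operator on power series by which a letter acts: with `σ` the substitution `t ↦ q t` and
`h = (1 - q) t / (1 - t)`, the letters `x` and `y` are the Jackson integrals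
`f ↦ (1 - σ)⁻¹ (1 - q) σ f` and `f ↦ (1 - σ)⁻¹ (h f)`, and `ρ` is multiplication by `h`. -/
noncomputable def letterOp (q : ℂ) : Letter → PowerSeries ℂ →ₗ[ℂ] PowerSeries ℂ
  | .x =>
    { toFun := fun f => qInv q (PowerSeries.C (1 - q) * PowerSeries.rescale q f)
      map_add' := fun f g => by rw [map_add, mul_add, map_add]
      map_smul' := fun c f => by rw [rescale_smul, mul_smul_comm, map_smul, RingHom.id_apply] }
  | .y => qInv q ∘ₗ LinearMap.mulLeft ℂ (geomSeries q)
  | .rho => LinearMap.mulLeft ℂ (geomSeries q)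

theorem letterOp_x (q : ℂ) (f : PowerSeries ℂ) :
    letterOp q .x f = qInv q (PowerSeries.C (1 - q) * PowerSeries.rescale q f) := rfl

theorem letterOp_y (q : ℂ) (f : PowerSeries ℂ) :
    letterOp q .y f = qInv q (geomSeries q * f) := rfl

theorem letterOp_rho (q : ℂ) (f : PowerSeries ℂ) :
    letterOp q .rho f = geomSeries q * f := rfl

theorem letterOp_y_mul_letterOp_y {q : ℂ} (hq : ‖q‖ < 1) (f g : PowerSeries ℂ) :
    letterOp q .y f * letterOp q .y g =
      letterOp q .y (f * letterOp q .y g + letterOp q .y f * g - geomSeries q * (f * g)) := by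
  simp only [letterOp_y]
  rw [qInv_mul_qInv hq (by simp) (by simp)]
  congr 1
  ring

theorem letterOp_x_mul_letterOp_y {q : ℂ} (hq : ‖q‖ < 1) {f : PowerSeries ℂ} (g : PowerSeries ℂ)
    (hf : PowerSeries.constantCoeff f = 0) :
    letterOp q .x f * letterOp q .y g =
      letterOp q .x (f * letterOp q .y g) + letterOp q .y (letterOp q .x f * g) := by
  simp only [letterOp_y, letterOp_x]
  rw [qInv_mul_qInv hq (by simp [hf]) (by simp), ← map_add]
  congr 1
  rw [map_mul (PowerSeries.rescale q), qInv_sub_rescale hq (f := geomSeries q * g) (by simp)]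
  ring

theorem letterOp_x_mul_letterOp_x {q : ℂ} (hq : ‖q‖ < 1) {f g : PowerSeries ℂ}
    (hf : PowerSeries.constantCoeff f = 0) (hg : PowerSeries.constantCoeff g = 0) :
    letterOp q .x f * letterOp q .x g =
      letterOp q .x (f * letterOp q .x g + letterOp q .x f * g +
        PowerSeries.C (1 - q) * (f * g)) := by
  simp only [letterOp_x]
  rw [qInv_mul_qInv hq (by simp [hf]) (by simp [hg])]
  congr 1
  simp only [map_add (PowerSeries.rescale q), map_mul (PowerSeries.rescale q)]
  rw [qInv_sub_rescale hq (by simp [hg]), qInv_sub_rescale hq (by simp [hf]), rescale_C]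
  ring

/-! ### The power series of an element of the algebra -/

/-- The power series of a word: its letters applied in turn to the series `1`. -/
noncomputable def wordPS (q : ℂ) (w : List Letter) : PowerSeries ℂ :=
  w.foldr (fun u f => letterOp q u f) 1

/-- The linear extension of `wordPS`, where `ħ` acts on power series as `1 - q`. -/
noncomputable def toPS (q : ℂ) : H →ₛₗ[coefEval q] PowerSeries ℂ where
  toFun f := ((FreeAlgebra.basisFreeMonoid Coef Letter).repr f).sum
    fun w c => coefEval q c • wordPS q w.toList
  map_add' f g := by
    rw [map_add]
    exact Finsupp.sum_add_index'
      (h := fun (w : FreeMonoid Letter) c => coefEval q c • wordPS q w.toList)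
      (fun w => by simp) (fun w c d => by simp [add_smul])
  map_smul' c f := by
    rw [map_smul, Finsupp.sum_smul_index (by simp), Finsupp.smul_sum]
    simp [mul_smul]

theorem toPS_word (q : ℂ) (w : List Letter) : toPS q (word w) = wordPS q w := by
  change ((FreeAlgebra.basisFreeMonoid Coef Letter).repr (word w)).sum
    (fun w c => coefEval q c • wordPS q w.toList) = _
  rw [← basis_ofList, Module.Basis.repr_self, Finsupp.sum_single_index (by simp), map_one,
    one_smul]
  rfl

theorem toPS_one (q : ℂ) : toPS q 1 = 1 := toPS_word q []

theorem toPS_gen_mul (q : ℂ) (u : Letter) (a : H) :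
    toPS q (gen u * a) = letterOp q u (toPS q a) := by
  induction a using word_induction with
  | hw w => rw [← word_cons, toPS_word, toPS_word]; rfl
  | hadd a b ha hb => rw [mul_add, map_add, map_add, map_add, ha, hb]
  | hsmul c a ha => rw [mul_smul_comm, map_smulₛₗ, map_smulₛₗ, map_smul, ha]

theorem toPS_hbar_smul (q : ℂ) (a : H) :
    toPS q (hbar • a) = PowerSeries.C (1 - q) * toPS q a := by
  rw [map_smulₛₗ, ← PowerSeries.smul_eq_C_mul]
  simp [coefEval, hbar]

theorem constantCoeff_letterOp (q : ℂ) (u : Letter) (f : PowerSeries ℂ) :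
    PowerSeries.constantCoeff (letterOp q u f) = 0 := by
  cases u
  · simp [letterOp_x]
  · simp [letterOp_y]
  · simp [letterOp_rho]

theorem constantCoeff_toPS_word {q : ℂ} {w : List Letter} (hw : StartsXY w) :
    PowerSeries.constantCoeff (toPS q (word w)) = 0 := by
  cases w with
  | nil => exact hw.elim
  | cons u w => rw [word_cons, toPS_gen_mul, constantCoeff_letterOp]

/-- On good words the recursion of the shuffle product matches the product formulas of the letter
operators. The formulas for `x` need series without constant term; every letter following `x`
provides one. -/
theorem toPS_sh_word {q : ℂ} (hq : ‖q‖ < 1) {w w' : List Letter} (hw : Good w) (hw' : Good w') :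
    toPS q (sh (word w) (word w')) = toPS q (word w) * toPS q (word w') := by
  match w, w', hw, hw' with
  | [], w', _, _ => simp [toPS_one]
  | w, [], _, _ => simp [toPS_one]
  | .rho :: w, w', hw, hw' =>
    rw [word_cons, sh_rho_mul_left, toPS_gen_mul, toPS_gen_mul, toPS_sh_word (w := w) hq hw hw',
      letterOp_rho, letterOp_rho, mul_assoc]
  | w, .rho :: w', hw, hw' =>
    rw [word_cons, sh_rho_mul_right, toPS_gen_mul, toPS_gen_mul, toPS_sh_word (w' := w') hq hw hw',
      letterOp_rho, letterOp_rho, mul_left_comm]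
  | .x :: w, .x :: w', hw, hw' =>
    rw [word_cons, word_cons, sh_x_mul_x_mul, ← word_cons, ← word_cons, toPS_gen_mul,
      map_add (toPS q), map_add (toPS q), toPS_hbar_smul, toPS_sh_word hq hw.2 hw',
      toPS_sh_word hq hw hw'.2, toPS_sh_word hq hw.2 hw'.2, word_cons, word_cons,
      toPS_gen_mul, toPS_gen_mul,
      letterOp_x_mul_letterOp_x hq (constantCoeff_toPS_word hw.1) (constantCoeff_toPS_word hw'.1)]
  | .x :: w, .y :: w', hw, hw' =>
    rw [word_cons, word_cons, sh_x_mul_y_mul, ← word_cons, ← word_cons, map_add, toPS_gen_mul,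
      toPS_gen_mul, toPS_sh_word hq hw.2 hw', toPS_sh_word (w' := w') hq hw hw', word_cons,
      word_cons, toPS_gen_mul, toPS_gen_mul,
      letterOp_x_mul_letterOp_y hq _ (constantCoeff_toPS_word hw.1)]
  | .y :: w, .x :: w', hw, hw' =>
    rw [word_cons, word_cons, sh_y_mul_x_mul, ← word_cons, ← word_cons, map_add, toPS_gen_mul,
      toPS_gen_mul, toPS_sh_word hq hw hw'.2, toPS_sh_word (w := w) hq hw hw', word_cons,
      word_cons, toPS_gen_mul, toPS_gen_mul, mul_comm (letterOp q .y _) (letterOp q .x _),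
      letterOp_x_mul_letterOp_y hq _ (constantCoeff_toPS_word hw'.1), add_comm,
      mul_comm (toPS q (word w)), mul_comm (toPS q (word w'))]
  | .y :: w, .y :: w', hw, hw' =>
    rw [word_cons, word_cons, sh_y_mul_y_mul, ← word_cons, ← word_cons, toPS_gen_mul, map_sub,
      map_add, toPS_gen_mul q .rho, letterOp_rho, toPS_sh_word (w := w) hq hw hw',
      toPS_sh_word (w' := w') hq hw hw', toPS_sh_word (w := w) (w' := w') hq hw hw', word_cons,
      word_cons, toPS_gen_mul, toPS_gen_mul, letterOp_y_mul_letterOp_y hq]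
  termination_by w.length + w'.length

/-- The shuffle product becomes the product of power series. -/
theorem toPS_sh {q : ℂ} (hq : ‖q‖ < 1) {a b : H} (ha : a ∈ H1) (hb : b ∈ H1) :
    toPS q (sh a b) = toPS q a * toPS q b := by
  replace ha := H1_le_span_good ha
  replace hb := H1_le_span_good hb
  induction ha, hb using Submodule.span_induction₂ with
  | mem_mem a b ha hb =>
    obtain ⟨w, hw, rfl⟩ := ha
    obtain ⟨w', hw', rfl⟩ := hb
    exact toPS_sh_word hq hw hw'
  | zero_left => simp
  | zero_right => simp
  | add_left a b c _ _ _ ha hb => simp only [map_add, LinearMap.add_apply, ha, hb, add_mul]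
  | add_right a b c _ _ _ ha hb => simp only [map_add, ha, hb, mul_add]
  | smul_left r a b _ _ h =>
    rw [map_smul, LinearMap.smul_apply, map_smulₛₗ, map_smulₛₗ, h, smul_mul_assoc]
  | smul_right r a b _ _ h => rw [map_smul, map_smulₛₗ, map_smulₛₗ, h, mul_smul_comm]

theorem coeff_letterOp_x_iterate (q : ℂ) (f : PowerSeries ℂ) (k n : ℕ) :
    PowerSeries.coeff n ((letterOp q .x)^[k] f) =
      ((1 - q ^ n)⁻¹ * (1 - q) * q ^ n) ^ k * PowerSeries.coeff n f := by
  induction k with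
  | zero => simp
  | succ k ih =>
    rw [Function.iterate_succ_apply', letterOp_x, coeff_qInv, PowerSeries.coeff_C_mul,
      PowerSeries.coeff_rescale, ih]
    ring

theorem toPS_x_pow_mul (q : ℂ) (k : ℕ) (a : H) :
    toPS q (gen .x ^ k * a) = (letterOp q .x)^[k] (toPS q a) := by
  induction k with
  | zero => simp
  | succ k ih => rw [pow_succ', mul_assoc, toPS_gen_mul, ih, Function.iterate_succ_apply']

/-- The letters `ξ` and `z_k` act on coefficients by partial summation followed by the weight
`I_u(n)`. Both sides vanish at `n = 0`. -/
theorem coeff_toPS_toH_mul {q : ℂ} (hq : ‖q‖ < 1) (u : Alph) (a : H) (n : ℕ) :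
    PowerSeries.coeff n (toPS q (u.toH * a)) =
      I q u n * ∑ m ∈ Finset.range n, PowerSeries.coeff m (toPS q a) := by
  rcases eq_or_ne n 0 with rfl | hn
  · cases u with
    | xi => simp [Alph.toH, xi, sub_mul, toPS_gen_mul, constantCoeff_letterOp]
    | z k =>
      simp only [Alph.toH, z, mul_assoc, toPS_x_pow_mul, toPS_gen_mul, coeff_letterOp_x_iterate]
      simp [constantCoeff_letterOp]
  have h1 := one_sub_pow_ne_zero hq hn
  have h2 : 1 - q ≠ 0 := by simpa using one_sub_pow_ne_zero hq one_ne_zero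
  cases u with
  | xi =>
    simp only [Alph.toH, xi, sub_mul, map_sub, toPS_gen_mul, letterOp_y, letterOp_rho,
      coeff_qInv, coeff_geomSeries_mul, I, qInt]
    field_simp
    ring
  | z k =>
    simp only [Alph.toH, z, mul_assoc, toPS_x_pow_mul, toPS_gen_mul, coeff_letterOp_x_iterate,
      letterOp_y, coeff_qInv, coeff_geomSeries_mul, I, qInt]
    obtain ⟨j, hj⟩ : ∃ j, (k : ℕ) = j + 1 := ⟨k - 1, by have := k.pos; omega⟩
    rw [hj, Nat.add_sub_cancel]
    simp only [mul_pow, div_pow, pow_succ, ← pow_mul, inv_pow]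
    field_simp
    ring

/-! ### Sums over decreasing tuples -/

/-- The sum `∑_{n = n_1 > ⋯ > n_r > 0} ∏ W_{u_i}(n_i)` with prescribed largest index `n`. At the
empty word it is `1` for `n = 0` and `0` otherwise. -/
def chainSum {A R : Type*} [CommSemiring R] (W : A → ℕ → R) : List A → ℕ → R
  | [], n => if n = 0 then 1 else 0
  | a :: l, n => W a n * ∑ m ∈ Finset.range n, chainSum W l m

/-- The largest entry of a decreasing tuple, and `0` for the empty tuple. -/
def DecTuple.top : {r : ℕ} → DecTuple r → ℕ
  | 0, _ => 0
  | _ + 1, n => n.1 0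

theorem DecTuple.le_top {r : ℕ} (n : DecTuple r) (i : Fin r) : n.1 i ≤ n.top := by
  cases r with
  | zero => exact i.elim0
  | succ r => exact n.2.1.antitone (Fin.zero_le i)

theorem finite_top_eq (r N : ℕ) : Finite {n : DecTuple r // n.top = N} := by
  have : Finite (Set.Iic fun _ : Fin r => N) := Set.finite_Iic _
  refine Finite.of_injective
    (fun n => (⟨n.1.1, fun i => (n.1.le_top i).trans_eq n.2⟩ : Set.Iic fun _ : Fin r => N)) ?_
  rintro ⟨⟨n, _⟩, _⟩ ⟨⟨m, _⟩, _⟩ h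
  exact Subtype.ext (Subtype.ext (congrArg (fun n => n.1) h))

/-- The tuple `(N, n_1, …, n_r)` for `N > n_1`. -/
def DecTuple.cons {r : ℕ} (N : ℕ) (n : DecTuple r) (h : n.top < N) : DecTuple (r + 1) :=
  ⟨Fin.cons N n.1, by
    have hlt : ∀ i, n.1 i < N := fun i => (n.le_top i).trans_lt h
    refine ⟨fun i j hij => ?_, fun i => ?_⟩
    · induction j using Fin.cases with
      | zero => exact absurd hij (Fin.not_lt_zero i)
      | succ j =>
        induction i using Fin.cases with
        | zero => simpa using hlt j
        | succ i => simpa using n.2.1 (Fin.succ_lt_succ_iff.1 hij)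
    · induction i using Fin.cases with
      | zero => exact Nat.zero_lt_of_lt h
      | succ i => simpa using n.2.2 i⟩

theorem DecTuple.exists_cons {r : ℕ} (n : DecTuple (r + 1)) :
    ∃ (m : DecTuple r) (h : m.top < n.top), n = DecTuple.cons n.top m h := by
  refine ⟨⟨fun i => n.1 i.succ, fun i j hij => n.2.1 (Fin.succ_lt_succ_iff.2 hij),
    fun i => n.2.2 _⟩, ?_, ?_⟩
  · cases r with
    | zero => exact n.2.2 0
    | succ r => exact n.2.1 (Fin.succ_pos 0)
  · refine Subtype.ext (funext fun i => ?_)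
    induction i using Fin.cases with
    | zero => rfl
    | succ i => rfl

theorem bijective_cons (r N : ℕ) : Function.Bijective
    fun p : (M : Fin N) × {m : DecTuple r // m.top = M} =>
      (⟨DecTuple.cons N p.2.1 (p.2.2.trans_lt p.1.2), rfl⟩ :
        {n : DecTuple (r + 1) // n.top = N}) := by
  constructor
  · rintro ⟨⟨M, hM⟩, ⟨m, hm⟩⟩ ⟨⟨M', hM'⟩, ⟨m', hm'⟩⟩ h
    obtain rfl : m = m' := by
      refine Subtype.ext (funext fun i => ?_)
      have := congrArg (fun n => n.1.1 i.succ) h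
      simpa [DecTuple.cons] using this
    simp only at hm hm'
    subst hm
    subst hm'
    rfl
  · rintro ⟨n, rfl⟩
    obtain ⟨m, h, hn⟩ := n.exists_cons
    exact ⟨⟨⟨m.top, h⟩, ⟨m, rfl⟩⟩, Subtype.ext hn.symm⟩

/-- The tuples with largest entry `N` are finite in number, and removing that entry gives the
recursion of `chainSum`. -/
theorem hasSum_chainSum {A R : Type*} [CommSemiring R] [TopologicalSpace R] (W : A → ℕ → R)
    (l : List A) (N : ℕ) :
    HasSum (fun n : {n : DecTuple l.length // n.top = N} =>
      ∏ i : Fin l.length, W (l.get i) (n.1.1 i)) (chainSum W l N) := by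
  have : ∀ r N, Fintype {n : DecTuple r // n.top = N} := fun r N =>
    @Fintype.ofFinite _ (finite_top_eq r N)
  suffices h : ∑ n : {n : DecTuple l.length // n.top = N},
      ∏ i : Fin l.length, W (l.get i) (n.1.1 i) = chainSum W l N from h ▸ hasSum_fintype _
  induction l generalizing N with
  | nil =>
    have hu : ∀ n : DecTuple 0, n = ⟨Fin.elim0, fun i => i.elim0, fun i => i.elim0⟩ := fun n =>
      Subtype.ext (funext fun i => i.elim0)
    rcases eq_or_ne N 0 with rfl | hN
    · refine (Fintype.sum_eq_single (⟨⟨Fin.elim0, fun i => i.elim0, fun i => i.elim0⟩, rfl⟩ :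
        {n : DecTuple 0 // n.top = 0}) fun n hn => (hn (Subtype.ext (hu n.1))).elim).trans ?_
      simp [chainSum]
    · have : IsEmpty {n : DecTuple ([] : List A).length // n.top = N} :=
        ⟨fun n => hN n.2.symm⟩
      rw [Fintype.sum_empty]
      simp [chainSum, hN]
  | cons a l ih =>
    rw [chainSum, ← Fin.sum_univ_eq_sum_range, Finset.mul_sum]
    refine (Fintype.sum_bijective _ (bijective_cons l.length N) (fun p =>
      W a N * ∏ i : Fin l.length, W (l.get i) (p.2.1.1 i)) _ fun p => ?_).symm.trans ?_
    · exact (Fin.prod_univ_succ (n := l.length) fun i => W ((a :: l).get i)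
        ((DecTuple.cons N p.2.1 (p.2.2.trans_lt p.1.2)).1 i)).symm
    · rw [Fintype.sum_sigma]
      refine Finset.sum_congr rfl fun M _ => ?_
      rw [← ih, Finset.mul_sum]

/-! ### Convergence -/

theorem norm_one_div_qInt_le {q : ℂ} (hq : ‖q‖ < 1) (n : ℕ) :
    ‖1 / qInt q n‖ ≤ ‖1 - q‖ / (1 - ‖q‖) := by
  have h1 : 0 < 1 - ‖q‖ := sub_pos.2 hq
  rcases eq_or_ne n 0 with rfl | hn
  · simp only [qInt, pow_zero, sub_self, zero_div, div_zero, norm_zero]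
    positivity
  · rw [qInt, one_div_div, norm_div]
    refine div_le_div_of_nonneg_left (norm_nonneg _) h1 ?_
    calc 1 - ‖q‖ ≤ 1 - ‖q‖ ^ n :=
          sub_le_sub_left (pow_le_of_le_one (norm_nonneg q) hq.le hn) 1
      _ = ‖(1 : ℂ)‖ - ‖q ^ n‖ := by rw [norm_one, norm_pow]
      _ ≤ ‖1 - q ^ n‖ := norm_sub_norm_le _ _

/-- The weights are bounded, and decay geometrically except for `z_1`. -/
theorem exists_norm_I_le {q : ℂ} (hq : ‖q‖ < 1) (a : Alph) :
    ∃ K, 0 ≤ K ∧ ∀ n, ‖I q a n‖ ≤ K ∧ (a ≠ .z 1 → ‖I q a n‖ ≤ K * ‖q‖ ^ n) := by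
  have h1 : 0 < 1 - ‖q‖ := sub_pos.2 hq
  set C := ‖1 - q‖ / (1 - ‖q‖)
  have hC : 0 ≤ C := div_nonneg (norm_nonneg _) h1.le
  have hb : ∀ n, ‖q‖ ^ n ≤ 1 := fun n => pow_le_one₀ (norm_nonneg q) hq.le
  cases a with
  | xi =>
    refine ⟨C, hC, fun n => ?_⟩
    have h : ‖I q .xi n‖ ≤ C * ‖q‖ ^ n := by
      rw [I, div_eq_mul_one_div, norm_mul, norm_pow, mul_comm]
      gcongr
      exact norm_one_div_qInt_le hq n
    exact ⟨h.trans (mul_le_of_le_one_right hC (hb n)), fun _ => h⟩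
  | z k =>
    refine ⟨C ^ (k : ℕ), by positivity, fun n => ?_⟩
    have h : ‖I q (.z k) n‖ ≤ C ^ (k : ℕ) * ‖q‖ ^ (((k : ℕ) - 1) * n) := by
      rw [I, div_eq_mul_one_div, ← one_div_pow, norm_mul, norm_pow, norm_pow, mul_comm]
      gcongr
      exact norm_one_div_qInt_le hq n
    refine ⟨h.trans (mul_le_of_le_one_right (by positivity) (hb _)), fun hk => h.trans ?_⟩
    have hk1 : 1 ≤ (k : ℕ) - 1 := by
      have h0 : (k : ℕ) ≠ 1 := fun h => hk (by rw [PNat.coe_eq_one_iff.1 h])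
      have := k.pos
      omega
    gcongr 1
    exact pow_le_pow_of_le_one (norm_nonneg q) hq.le (Nat.le_mul_of_pos_left n hk1)

theorem chainSum_norm_nonneg (q : ℂ) (l : List Alph) (n : ℕ) :
    0 ≤ chainSum (fun a n => ‖I q a n‖) l n := by
  induction l generalizing n with
  | nil => rw [chainSum]; split_ifs <;> simp
  | cons a l ih => exact mul_nonneg (norm_nonneg _) (Finset.sum_nonneg fun m _ => ih m)

/-- Since the weights are bounded, the chain sums grow at most polynomially. -/
theorem exists_chainSum_norm_le {q : ℂ} (hq : ‖q‖ < 1) (l : List Alph) :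
    ∃ C, 0 ≤ C ∧ ∀ n, chainSum (fun a n => ‖I q a n‖) l n ≤ C * (n + 1 : ℕ) ^ l.length := by
  induction l with
  | nil =>
    refine ⟨1, zero_le_one, fun n => ?_⟩
    rw [chainSum]
    split_ifs <;> simp
  | cons a l ih =>
    obtain ⟨C, hC, h⟩ := ih
    obtain ⟨K, hK, hI⟩ := exists_norm_I_le hq a
    refine ⟨K * C, mul_nonneg hK hC, fun n => ?_⟩
    have hs : ∑ m ∈ Finset.range n, chainSum (fun a n => ‖I q a n‖) l m ≤
        C * (n + 1 : ℕ) ^ (l.length + 1) := by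
      calc _ ≤ ∑ m ∈ Finset.range n, C * ((n + 1 : ℕ) : ℝ) ^ l.length := by
            refine Finset.sum_le_sum fun m hm => (h m).trans ?_
            have := (Finset.mem_range.1 hm).le
            gcongr
        _ = n * (C * ((n + 1 : ℕ) : ℝ) ^ l.length) := by simp
        _ ≤ (n + 1 : ℕ) * (C * ((n + 1 : ℕ) : ℝ) ^ l.length) := by
            gcongr
            exact Nat.le_succ n
        _ = _ := by ring
    rw [chainSum, List.length_cons, mul_assoc]
    exact mul_le_mul (hI n).1 hs (Finset.sum_nonneg fun m _ => chainSum_norm_nonneg q l m) hK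

/-- A word which is empty or does not start with `z_1`. -/
def Admissible : List Alph → Prop
  | [] => True
  | a :: _ => a ≠ .z 1

theorem summable_chainSum_norm {q : ℂ} (hq : ‖q‖ < 1) {l : List Alph} (hl : Admissible l) :
    Summable (chainSum (fun a n => ‖I q a n‖) l) := by
  cases l with
  | nil =>
    refine summable_of_ne_finset_zero (s := {0}) fun n hn => ?_
    rw [chainSum, if_neg (by simpa using hn)]
  | cons a l =>
    obtain ⟨C, hC, h⟩ := exists_chainSum_norm_le hq l
    obtain ⟨K, hK, hI⟩ := exists_norm_I_le hq a
    have hsum : Summable fun n : ℕ => K * C * ((n : ℝ) ^ (l.length + 1) * ‖q‖ ^ n) :=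
      (summable_pow_mul_geometric_of_norm_lt_one (R := ℝ) _ (by simpa using hq)).mul_left (K * C)
    refine hsum.of_nonneg_of_le (chainSum_norm_nonneg q _) fun n => ?_
    have hs : ∑ m ∈ Finset.range n, chainSum (fun a n => ‖I q a n‖) l m ≤
        C * (n : ℝ) ^ (l.length + 1) := by
      calc _ ≤ ∑ m ∈ Finset.range n, C * (n : ℝ) ^ l.length := by
            refine Finset.sum_le_sum fun m hm => (h m).trans ?_
            have : m + 1 ≤ n := Finset.mem_range.1 hm
            gcongr
        _ = _ := by simp; ring
    rw [chainSum]
    calc _ ≤ K * ‖q‖ ^ n * (C * (n : ℝ) ^ (l.length + 1)) :=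
          mul_le_mul ((hI n).2 hl) hs (Finset.sum_nonneg fun m _ => chainSum_norm_nonneg q l m)
            (by positivity)
      _ = _ := by ring

theorem summable_norm_term {q : ℂ} (hq : ‖q‖ < 1) {l : List Alph} (hl : Admissible l) :
    Summable fun n => ‖term q l n‖ := by
  rw [← (Equiv.sigmaFiberEquiv (DecTuple.top (r := l.length))).summable_iff]
  refine (summable_sigma_of_nonneg fun _ => norm_nonneg _).2 ?_
  have h := hasSum_chainSum (fun a n => ‖I q a n‖) l
  simp only [← norm_prod] at h
  exact ⟨fun N => (h N).summable,
    (summable_chainSum_norm hq hl).congr fun N => (h N).tsum_eq.symm⟩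

theorem hasSum_wordSeries {q : ℂ} (hq : ‖q‖ < 1) {l : List Alph} (hl : Admissible l) :
    HasSum (chainSum (I q) l) (wordSeries q l) := by
  have h := (summable_norm_term hq hl).of_norm.hasSum
  rw [← (Equiv.sigmaFiberEquiv (DecTuple.top (r := l.length))).hasSum_iff] at h
  exact h.sigma fun N => hasSum_chainSum (I q) l N

/-! ### The evaluation as a sum of coefficients -/

/-- The element of the free algebra on `A` given by a word. -/
noncomputable def alphWord (l : List Alph) : FreeAlgebra Coef Alph :=
  (l.map (FreeAlgebra.ι Coef)).prod

theorem alphWord_cons (a : Alph) (l : List Alph) :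
    alphWord (a :: l) = FreeAlgebra.ι Coef a * alphWord l := rfl

theorem evalA_ι_mul (a : Alph) (f : FreeAlgebra Coef Alph) :
    evalA (FreeAlgebra.ι Coef a * f) = a.toH * evalA f := by
  rw [map_mul]
  simp [evalA]

theorem freeZ_alphWord (q : ℂ) (l : List Alph) : freeZ q (alphWord l) = wordSeries q l := by
  have h : alphWord l = FreeAlgebra.basisFreeMonoid Coef Alph (FreeMonoid.ofList l) :=
    (basisFreeMonoid_apply (FreeMonoid.ofList l)).symm
  change ((FreeAlgebra.basisFreeMonoid Coef Alph).repr (alphWord l)).sum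
    (fun w c => coefEval q c * wordSeries q w.toList) = _
  rw [h, Module.Basis.repr_self, Finsupp.sum_single_index (by simp), map_one, one_mul]
  rfl

theorem coeff_toPS_alphWord {q : ℂ} (hq : ‖q‖ < 1) (l : List Alph) (n : ℕ) :
    PowerSeries.coeff n (toPS q (evalA (alphWord l))) = chainSum (I q) l n := by
  induction l generalizing n with
  | nil =>
    change PowerSeries.coeff n (toPS q (evalA 1)) = _
    rw [map_one, toPS_one, PowerSeries.coeff_one, chainSum]
  | cons a l ih =>
    rw [alphWord_cons, evalA_ι_mul, coeff_toPS_toH_mul hq, chainSum]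
    simp only [ih]

theorem norm_chainSum_le (q : ℂ) (l : List Alph) (n : ℕ) :
    ‖chainSum (I q) l n‖ ≤ chainSum (fun a n => ‖I q a n‖) l n := by
  induction l generalizing n with
  | nil => rw [chainSum, chainSum]; split_ifs <;> simp
  | cons a l ih =>
    rw [chainSum, chainSum, norm_mul]
    gcongr
    exact (norm_sum_le _ _).trans (Finset.sum_le_sum fun m _ => ih m)

theorem summable_and_hasSum_coeff {q : ℂ} (hq : ‖q‖ < 1) {f : FreeAlgebra Coef Alph}
    (hf : f ∈ Submodule.span Coef (alphWord '' {l | Admissible l})) :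
    (Summable fun n => ‖PowerSeries.coeff n (toPS q (evalA f))‖) ∧
      HasSum (fun n => PowerSeries.coeff n (toPS q (evalA f))) (freeZ q f) := by
  induction hf using Submodule.span_induction with
  | mem f h =>
    obtain ⟨l, hl, rfl⟩ := h
    simp only [coeff_toPS_alphWord hq, freeZ_alphWord]
    exact ⟨(summable_chainSum_norm hq hl).of_nonneg_of_le (fun _ => norm_nonneg _)
      (norm_chainSum_le q l), hasSum_wordSeries hq hl⟩
  | zero => simp [summable_zero, hasSum_zero]
  | add f g _ _ hf hg =>
    simp only [map_add]
    exact ⟨(hf.1.add hg.1).of_nonneg_of_le (fun _ => norm_nonneg _) fun _ => norm_add_le _ _,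
      hf.2.add hg.2⟩
  | smul c f _ hf =>
    simp only [map_smul, map_smulₛₗ, smul_eq_mul, norm_mul]
    exact ⟨hf.1.mul_left _, hf.2.mul_left _⟩

theorem span_range_alphWord : Submodule.span Coef (Set.range alphWord) = ⊤ := by
  rw [← (FreeAlgebra.basisFreeMonoid Coef Alph).span_eq]
  congr 1
  exact Set.Subset.antisymm
    (by rintro _ ⟨w, rfl⟩; exact ⟨FreeMonoid.ofList w, basisFreeMonoid_apply _⟩)
    (by rintro _ ⟨w, rfl⟩; exact ⟨w.toList, (basisFreeMonoid_apply w).symm⟩)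

theorem H0hat_le_map_span : H0hat ≤
    (Submodule.span Coef (alphWord '' {l | Admissible l})).map evalA.toLinearMap := by
  have key : ∀ a : Alph, a ≠ .z 1 → H1.toSubmodule.map (LinearMap.mulLeft Coef a.toH) ≤
      (Submodule.span Coef (alphWord '' {l | Admissible l})).map evalA.toLinearMap := by
    rintro a ha _ ⟨w, hw, rfl⟩
    have hw' : w ∈ evalA.range := range_evalA ▸ hw
    obtain ⟨f, rfl⟩ := hw'
    refine ⟨FreeAlgebra.ι Coef a * f, ?_, evalA_ι_mul a f⟩
    have hf : f ∈ Submodule.span Coef (Set.range alphWord) :=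
      span_range_alphWord ▸ Submodule.mem_top
    suffices h : Submodule.span Coef (Set.range alphWord) ≤
        (Submodule.span Coef (alphWord '' {l | Admissible l})).comap
          (LinearMap.mulLeft Coef (FreeAlgebra.ι Coef a)) from h hf
    rw [Submodule.span_le]
    rintro _ ⟨l, rfl⟩
    exact Submodule.subset_span ⟨a :: l, ha, rfl⟩
  refine sup_le (sup_le ?_ (key .xi (by simp))) (iSup₂_le fun k hk => key (.z k) ?_)
  · rw [Submodule.span_le, Set.singleton_subset_iff]
    exact ⟨alphWord [], Submodule.subset_span ⟨[], trivial, rfl⟩, map_one evalA⟩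
  · rintro h
    rw [Alph.z.injEq] at h
    subst h
    exact absurd hk (by decide)

/-- On `H0hat` the map `Z` is the value at `t = 1` of the associated power series, which converges
absolutely there. -/
theorem summable_and_hasSum_Z {q : ℂ} (hq : ‖q‖ < 1) (w : H0hat) :
    (Summable fun n => ‖PowerSeries.coeff n (toPS q w)‖) ∧
      HasSum (fun n => PowerSeries.coeff n (toPS q w)) (Z q w) := by
  obtain ⟨w, hw⟩ := w
  obtain ⟨f, hf, rfl⟩ := H0hat_le_map_span hw
  have hZ : Z q ⟨evalA.toLinearMap f, hw⟩ = freeZ q f := by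
    change freeZ q (freeEquivH1.symm ⟨evalA f, H0hat_le_H1 hw⟩) = _
    congr 1
    rw [AlgEquiv.symm_apply_eq]
    rfl
  rw [hZ]
  exact summable_and_hasSum_coeff hq hf

end QShuffle

theorem mainTheorem1 (q : ℂ) (hq0 : 0 < ‖q‖) (hq1 : ‖q‖ < 1) :
    (∀ (u : QShuffle.Alph) (l : List QShuffle.Alph), u ≠ QShuffle.Alph.z 1 →
      Summable fun n => ‖QShuffle.term q (u :: l) n‖) ∧
    ∀ w w' : QShuffle.H0hat,
      ∃ h : QShuffle.sh (w : QShuffle.H) (w' : QShuffle.H) ∈ QShuffle.H0hat,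
        QShuffle.Z q ⟨QShuffle.sh (w : QShuffle.H) (w' : QShuffle.H), h⟩ =
          QShuffle.Z q w * QShuffle.Z q w' := by
  refine ⟨fun u l hu => QShuffle.summable_norm_term hq1 hu, fun w w' => ?_⟩
  have h := QShuffle.sh_mem_H0hat w.2 w'.2
  refine ⟨h, ?_⟩
  obtain ⟨hs, hw⟩ := QShuffle.summable_and_hasSum_Z hq1 w
  obtain ⟨hs', hw'⟩ := QShuffle.summable_and_hasSum_Z hq1 w'
  -- The three values are sums of coefficients, so the claim is the Cauchy product formula.
  rw [← (QShuffle.summable_and_hasSum_Z hq1 ⟨_, h⟩).2.tsum_eq, ← hw.tsum_eq, ← hw'.tsum_eq,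
    tsum_mul_tsum_eq_tsum_sum_antidiagonal_of_summable_norm hs hs']
  refine tsum_congr fun n => ?_
  rw [← PowerSeries.coeff_mul,
    ← QShuffle.toPS_sh hq1 (QShuffle.H0hat_le_H1 w.2) (QShuffle.H0hat_le_H1 w'.2)]
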